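/- Let $\{\omega_m\}_{m\ge 1}$ be a sequence of positive real numbers. Let $X$ be the Jacobi operator on $\ell_2(\mathbb{N})$ (with orthonormal basis $\delta_0,\delta_1,\dots$) whose domain is the space of finitely supported sequences and whose matrix is tridiagonal with zero diagonal and off-diagonal entries $\sqrt{\omega_1},\sqrt{\omega_2},\dots$, so that $X\delta_0=\sqrt{\omega_1}\,\delta_1$ and $X\delta_k=\sqrt{\omega_k}\,\delta_{k-1}+\sqrt{\omega_{k+1}}\,\delta_{k+1}$ for $k\ge 1$. Let $X^*$ be its adjoint, and let $X_m$ be the truncation of this matrix to the indices $0,\dots,m$. Put $Y^{(m)}=(i-X_m)^{-1}$, regarded as a bounded operator on $\ell_2(\mathbb{N})$ that vanishes on the orthogonal complement of $\mathrm{span}(\delta_0,\dots,\delta_m)$, and $G_m(i)=\langle Y^{(m)}\delta_0,\delta_0\rangle$. Put $G_{\mathrm{even}}=\lim_m G_{2m}(i)$ and $G_{\mathrm{odd}}=\lim_m G_{2m+1}(i)$; these limits exist. Let $B_{-1}=B_0=1$ and $B_m=B_{m-1}+\omega_mB_{m-2}$ for $m\ge1$. The sequence $\{\omega_m\}$ has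 property (SC) if one of the following conditions (which are equivalent) holds: (1) $G_{\mathrm{even}}\ne G_{\mathrm{odd}}$; (2) $\lim_{m\to\infty}\prod_{n=1}^m\left(1-\frac{B_{n-1}}{B_n}\right)>0$; (3) $\lim_{m\to\infty}\sum_{n=1}^m\frac{B_{n-1}}{B_n}<\infty$. **Proposition.** Suppose that $\{\omega_m\}$ has property (SC). Then the sequences $\{Y^{(2m)}\}_m$ and $\{Y^{(2m+1)}\}_m$ converge in the strong operator topology to bounded operators $Y^{\mathrm{even}}$ and $Y^{\mathrm{odd}}$, whose images are contained in $\mathrm{Dom}(X^*)$. Define $X_{\mathrm{even}}=X^*|_{\mathrm{Image}\,Y^{\mathrm{even}}}$ and $X_{\mathrm{odd}}=X^*|_{\mathrm{Image}\,Y^{\mathrm{odd}}}$. Then: - $X_{\mathrm{even}}$ and $X_{\mathrm{odd}}$ are extensions of $X$; - $X_{\mathrm{even}}$ and $X_{\mathrm{odd}}$ are self-adjoint; - $X$, $X_{\mathrm{even}}$ and $X_{\mathrm{odd}}$ have finite moments of all orders with respect to the state $\langle\,\cdot\,\delta_0,\delta_0\rangle$ (that is, $\delta_0$ lies in the domain of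 every power), these moments $M_n=\langle X^n\delta_0,\delta_0\rangle=\langle X_{\mathrm{even}}^n\delta_0,\delta_0\rangle=\langle X_{\mathrm{odd}}^n\delta_0,\delta_0\rangle$ coincide and are real, and their Jacobi sequence is $\{\omega_m\}$: $M_0=1$, and there are monic polynomials $P_n$ of degree $n$, orthogonal with positive square norms for the functional $x^n\mapsto M_n$, with $xP_0=P_1$ and $xP_n=P_{n+1}+\omega_nP_{n-1}$ for $n\ge1$; - the operators $i-X_{\mathrm{even}}$ and $i-X_{\mathrm{odd}}$ have bounded inverses, and the Stieltjes transforms at $i$ are $\langle(i-X_{\mathrm{even}})^{-1}\delta_0,\delta_0\rangle=G_{\mathrm{even}}$ and $\langle(i-X_{\mathrm{odd}})^{-1}\delta_0,\delta_0\rangle=G_{\mathrm{odd}}$, and these two numbers are different. -/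

import Mathlib

open Filter Topology

noncomputable section

namespace JacobiMoment

/-- The Hilbert space `ℓ₂(ℕ)` of square summable complex sequences. -/
abbrev EllTwo : Type := lp (fun _ : ℕ => ℂ) 2

/-- The unit vector `δ_k`. -/
def delta (k : ℕ) : EllTwo := lp.single 2 k (1 : ℂ)

/-! A Jacobi sequence `ω_1, ω_2, …` is a function `ω : ℕ → ℝ` whose value at `0` is never used. -/

/-- The tridiagonal matrix with zero diagonal and off-diagonal entries `√ω_1, √ω_2, …`
applied to a column of numbers. -/
def jacobiAction (ω : ℕ → ℝ) (v : ℕ → ℂ) : ℕ → ℂ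
  | 0 => (Real.sqrt (ω 1) : ℂ) * v 1
  | n + 1 => (Real.sqrt (ω (n + 1)) : ℂ) * v n + (Real.sqrt (ω (n + 2)) : ℂ) * v (n + 2)

theorem jacobiAction_add (ω : ℕ → ℝ) (v w : ℕ → ℂ) :
    jacobiAction ω (v + w) = jacobiAction ω v + jacobiAction ω w := by
  funext n
  cases n <;> simp [jacobiAction] <;> ring

theorem jacobiAction_smul (ω : ℕ → ℝ) (c : ℂ) (v : ℕ → ℂ) :
    jacobiAction ω (c • v) = c • jacobiAction ω v := by
  funext n
  cases n <;> simp [jacobiAction] <;> ring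

theorem jacobiAction_support_finite (ω : ℕ → ℝ) (v : ℕ → ℂ) (hv : (Function.support v).Finite) :
    (Function.support (jacobiAction ω v)).Finite := by
  obtain ⟨N, hN⟩ := hv.bddAbove
  have hz : ∀ k, N < k → v k = 0 := by
    intro k hk
    by_contra h
    exact absurd (hN h) (by omega)
  refine (Set.finite_Iic (N + 1)).subset ?_
  intro n hn
  by_contra h
  simp only [Set.mem_Iic, not_le] at h
  apply hn
  cases n with
  | zero => omega
  | succ k => simp [jacobiAction, hz k (by omega), hz (k + 2) (by omega)]

theorem memlp_of_support_finite (v : ℕ → ℂ) (hv : (Function.support v).Finite) :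
    Memℓp (E := fun _ : ℕ => ℂ) v 2 :=
  (memℓp_zero (E := fun _ : ℕ => ℂ) hv).of_exponent_ge zero_le

/-- The algebraic direct sum `⊕_ℕ ℂ ⊂ ℓ₂(ℕ)` of finitely supported sequences. -/
def finSupp : Submodule ℂ EllTwo where
  carrier := {ξ | (Function.support (ξ : ℕ → ℂ)).Finite}
  add_mem' {a b} ha hb := by
    refine (Set.Finite.union ha hb).subset ?_
    exact Function.support_add (a : ℕ → ℂ) (b : ℕ → ℂ)
  zero_mem' := by
    change (Function.support (fun _ : ℕ => (0 : ℂ))).Finite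
    simp
  smul_mem' c x hx := by
    refine Set.Finite.subset hx ?_
    exact Function.support_const_smul_subset c (x : ℕ → ℂ)

/-- The Jacobi operator `X` with domain the finitely supported sequences. -/
def jacobiOp (ω : ℕ → ℝ) : EllTwo →ₗ.[ℂ] EllTwo where
  domain := finSupp
  toFun :=
    { toFun := fun ξ => ⟨jacobiAction ω ((ξ : EllTwo) : ℕ → ℂ),
        memlp_of_support_finite _ (jacobiAction_support_finite ω _ ξ.2)⟩
      map_add' := fun _ _ => Subtype.ext (jacobiAction_add ω _ _)
      map_smul' := fun c _ => Subtype.ext (jacobiAction_smul ω c _) }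

/-- The truncated `(m + 1) × (m + 1)` Jacobi matrix `X_m`. -/
def truncMatrix (ω : ℕ → ℝ) (m : ℕ) : Matrix (Fin (m + 1)) (Fin (m + 1)) ℂ :=
  Matrix.of fun l k =>
    if (l : ℕ) + 1 = k then (Real.sqrt (ω k) : ℂ)
    else if (k : ℕ) + 1 = l then (Real.sqrt (ω l) : ℂ)
    else 0

/-- The matrix `(i - X_m)⁻¹`. -/
def truncResolventMatrix (ω : ℕ → ℝ) (m : ℕ) : Matrix (Fin (m + 1)) (Fin (m + 1)) ℂ :=
  (Complex.I • (1 : Matrix (Fin (m + 1)) (Fin (m + 1)) ℂ) - truncMatrix ω m)⁻¹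

/-- `(i - X_m)⁻¹` as an operator on `ℓ₂(ℕ)`: it acts on `ℓ₂({0, …, m})` and vanishes on the
orthogonal complement. -/
def truncResolvent (ω : ℕ → ℝ) (m : ℕ) : EllTwo →L[ℂ] EllTwo :=
  ∑ l : Fin (m + 1), ∑ k : Fin (m + 1),
    truncResolventMatrix ω m l k • (innerSL ℂ (delta k)).smulRight (delta l)

/-- The Stieltjes transform `G_m(i)` of `X_m` at `i`, the upper-left entry of `(i - X_m)⁻¹`. -/
def truncStieltjes (ω : ℕ → ℝ) (m : ℕ) : ℂ := truncResolventMatrix ω m 0 0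

/-- `G_even = lim G_{2m}(i)`. -/
def GEven (ω : ℕ → ℝ) : ℂ := limUnder atTop fun m : ℕ => truncStieltjes ω (2 * m)

/-- `G_odd = lim G_{2m+1}(i)`. -/
def GOdd (ω : ℕ → ℝ) : ℂ := limUnder atTop fun m : ℕ => truncStieltjes ω (2 * m + 1)

/-- The sequence `B_0 = 1`, `B_1 = 1 + ω_1`, `B_m = B_{m-1} + ω_m B_{m-2}`. -/
def seqB (ω : ℕ → ℝ) : ℕ → ℝ
  | 0 => 1
  | 1 => 1 + ω 1
  | n + 2 => seqB ω (n + 1) + ω (n + 2) * seqB ω n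

/-- Property (SC): at least one of three conditions (equivalent for positive `ω`) holds, namely
`G_even ≠ G_odd`, `lim ∏_{n=1}^m (1 - B_{n-1}/B_n) > 0`, `lim ∑_{n=1}^m B_{n-1}/B_n < ∞`. -/
def PropertySC (ω : ℕ → ℝ) : Prop :=
  GEven ω ≠ GOdd ω ∨
  (∃ L : ℝ, 0 < L ∧
    Tendsto (fun m : ℕ => ∏ n ∈ Finset.range m, (1 - seqB ω n / seqB ω (n + 1))) atTop (𝓝 L)) ∨
  (∃ S : ℝ,
    Tendsto (fun m : ℕ => ∑ n ∈ Finset.range m, seqB ω n / seqB ω (n + 1)) atTop (𝓝 S))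

/-- `Y` is the limit of `A` in the strong operator topology. -/
def IsStrongLimit (A : ℕ → EllTwo →L[ℂ] EllTwo) (Y : EllTwo →L[ℂ] EllTwo) : Prop :=
  ∀ ξ, Tendsto (fun m => A m ξ) atTop (𝓝 (Y ξ))

/-- The restriction of `X*` to the image of `Y`. -/
def adjointOnImage (ω : ℕ → ℝ) (Y : EllTwo →L[ℂ] EllTwo) : EllTwo →ₗ.[ℂ] EllTwo :=
  (jacobiOp ω).adjoint.domRestrict (LinearMap.range (Y : EllTwo →ₗ[ℂ] EllTwo))

/-- The bounded operator `R` is the two-sided inverse `(z - T)⁻¹` of `z - T : Dom T → ℓ₂(ℕ)`. -/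
def IsResolvent (T : EllTwo →ₗ.[ℂ] EllTwo) (z : ℂ) (R : EllTwo →L[ℂ] EllTwo) : Prop :=
  (∀ ξ : EllTwo, ∃ h : R ξ ∈ T.domain, z • R ξ - T ⟨R ξ, h⟩ = ξ) ∧
  (∀ ξ : T.domain, R (z • (ξ : EllTwo) - T ξ) = ξ)

/-- `z - T` has a bounded inverse, and the Stieltjes transform `⟨(z - T)⁻¹ δ_0, δ_0⟩` is `g`
(Mathlib's inner product is linear in its second entry). -/
def HasStieltjesTransform (T : EllTwo →ₗ.[ℂ] EllTwo) (z g : ℂ) : Prop :=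
  ∃ R : EllTwo →L[ℂ] EllTwo, IsResolvent T z R ∧ inner ℂ (delta 0) (R (delta 0)) = g

theorem HasStieltjesTransform.unique {T : EllTwo →ₗ.[ℂ] EllTwo} {z g g' : ℂ}
    (h : HasStieltjesTransform T z g) (h' : HasStieltjesTransform T z g') : g = g' := by
  obtain ⟨R, hR, rfl⟩ := h
  obtain ⟨R', hR', rfl⟩ := h'
  obtain ⟨hm, he⟩ := hR.1 (delta 0)
  have h2 := hR'.2 ⟨R (delta 0), hm⟩
  rw [he] at h2
  rw [h2]

/-- All powers `T^n δ_0` exist, and the moments `⟨T^n δ_0, δ_0⟩` with respect to the state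
`⟨· δ_0, δ_0⟩` are the real numbers `M n`; here `v n = T^n δ_0`. -/
def HasMoments (T : EllTwo →ₗ.[ℂ] EllTwo) (M : ℕ → ℝ) : Prop :=
  ∃ v : ℕ → EllTwo, v 0 = delta 0 ∧
    (∀ n, ∃ h : v n ∈ T.domain, T ⟨v n, h⟩ = v (n + 1)) ∧
    ∀ n, inner ℂ (delta 0) (v n) = (M n : ℂ)

/-- The linear functional on polynomials with `X ^ n ↦ M n`. -/
def momentFunctional (M : ℕ → ℝ) (p : Polynomial ℝ) : ℝ := p.sum fun n a => a * M n

/-- `ω` is the Jacobi sequence of the (symmetric) moment sequence `M`: the monic orthogonal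
polynomials `P_n` of `M` satisfy `x P_n = P_{n+1} + ω_n P_{n-1}`, with `P_{-1} = 0`. -/
def IsJacobiSequence (M ω : ℕ → ℝ) : Prop :=
  M 0 = 1 ∧ ∃ P : ℕ → Polynomial ℝ,
    (∀ n, (P n).Monic ∧ (P n).natDegree = n) ∧
    (∀ m n, m ≠ n → momentFunctional M (P m * P n) = 0) ∧
    (∀ n, 0 < momentFunctional M (P n * P n)) ∧
    Polynomial.X * P 0 = P 1 ∧
    ∀ n, Polynomial.X * P (n + 1) = P (n + 2) + Polynomial.C (ω (n + 1)) * P n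

end JacobiMoment

end

open JacobiMoment

/-! The orthonormal polynomials at `i` are `p_n(i) = i^n a_n` with `a_n > 0` (`absPoly`). Put `S_n =
a_0^2 + ... + a_n^2` (`sqSum`). The identity `√ω_{n+1} a_n a_{n+1} = S_n` turns the products in (SC)
into `1 / S_m`, and the Green kernel of `X_m` gives `G_m(i) = -i ∑_{j ≤ m} (-1)^j / S_j`. Hence each
form of (SC) forces `S` to be bounded, that is `∑ |p_n(i)|^2 < ∞` (`exists_sqSum_le`), and then
`G_even - G_odd = -i lim 1 / S_m ≠ 0`.

The matrix `(i - X_m)⁻¹` has entries `p_{min(l,k)} q_{max(l,k)}`, where `q` is a second solution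
with weights `t_n` satisfying `t_n + t_{n+1} = 1 / S_n` and `t_{m+1} = 0`. These weights lie in `[0,
1]`, so the entries are bounded by `a_l a_k` uniformly in `m`. When `a` is square summable,
dominated convergence gives strong limits along each parity (`exists_strongLimit`).

Three relations pass to a limit `Y` (`IsLimitResolvent`): `Y ξ` solves `(i - X) Y ξ = ξ`
coordinatewise, `Y* - Y = 2i Y* Y`, and `Y` is symmetric for the bilinear form `∑ x_k y_k`. The
operator statements follow from these alone. The moments are computed on finitely supported vectors,
so all extensions share them. -/

namespace JacobiMoment

/-- The absolute values of the orthonormal polynomials of `ω` at `i`. -/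
noncomputable def absPoly (ω : ℕ → ℝ) : ℕ → ℝ
  | 0 => 1
  | 1 => 1 / Real.sqrt (ω 1)
  | n + 2 => (absPoly ω (n + 1) + Real.sqrt (ω (n + 1)) * absPoly ω n) / Real.sqrt (ω (n + 2))

/-- The partial sums of the squares of `absPoly`. -/
noncomputable def sqSum (ω : ℕ → ℝ) (n : ℕ) : ℝ := ∑ k ∈ Finset.range (n + 1), absPoly ω k ^ 2

/-- The alternating sum `∑_{j < d} (-1) ^ j / S_{n + j}` with `S = sqSum ω`. -/
noncomputable def altSum (ω : ℕ → ℝ) : ℕ → ℕ → ℝ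
  | 0, _ => 0
  | d + 1, n => (sqSum ω n)⁻¹ - altSum ω d (n + 1)

/-! ### Orthonormal polynomials at `i` and property (SC) -/

section Sequences

variable {ω : ℕ → ℝ}

theorem sqrt_jacobi_pos (hω : ∀ n, 1 ≤ n → 0 < ω n) (n : ℕ) : 0 < Real.sqrt (ω (n + 1)) :=
  Real.sqrt_pos.2 (hω _ (by omega))

theorem absPoly_pos (hω : ∀ n, 1 ≤ n → 0 < ω n) : ∀ n, 0 < absPoly ω n
  | 0 => by simp [absPoly]
  | 1 => by simpa [absPoly] using hω 1 le_rfl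
  | n + 2 => by
    have h0 := absPoly_pos hω n
    have h1 := absPoly_pos hω (n + 1)
    have h2 := sqrt_jacobi_pos hω (n + 1)
    have h3 := sqrt_jacobi_pos hω n
    rw [absPoly]
    positivity

theorem sqrt_mul_absPoly_one (hω : ∀ n, 1 ≤ n → 0 < ω n) :
    Real.sqrt (ω 1) * absPoly ω 1 = absPoly ω 0 := by
  have h := (sqrt_jacobi_pos hω 0).ne'
  simp only [zero_add] at h
  simp only [absPoly]
  field_simp

theorem sqrt_mul_absPoly (hω : ∀ n, 1 ≤ n → 0 < ω n) (n : ℕ) :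
    Real.sqrt (ω (n + 2)) * absPoly ω (n + 2) =
      absPoly ω (n + 1) + Real.sqrt (ω (n + 1)) * absPoly ω n := by
  have h : Real.sqrt (ω (n + 2)) ≠ 0 := (sqrt_jacobi_pos hω (n + 1)).ne'
  rw [absPoly]
  field_simp

theorem sqSum_zero : sqSum ω 0 = 1 := by simp [sqSum, absPoly]

theorem sqSum_succ (n : ℕ) : sqSum ω (n + 1) = sqSum ω n + absPoly ω (n + 1) ^ 2 := by
  rw [sqSum, Finset.sum_range_succ, sqSum]

theorem sqSum_mono : Monotone (sqSum ω) :=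
  monotone_nat_of_le_succ fun n => by rw [sqSum_succ]; nlinarith [sq_nonneg (absPoly ω (n + 1))]

theorem one_le_sqSum (n : ℕ) : 1 ≤ sqSum ω n := sqSum_zero (ω := ω) ▸ sqSum_mono (Nat.zero_le n)

theorem sqSum_pos (n : ℕ) : 0 < sqSum ω n := zero_lt_one.trans_le (one_le_sqSum n)

theorem sqSum_inv_anti {m n : ℕ} (h : m ≤ n) : (sqSum ω n)⁻¹ ≤ (sqSum ω m)⁻¹ :=
  inv_anti₀ (sqSum_pos m) (sqSum_mono h)

theorem sqSum_inv_le_one (n : ℕ) : (sqSum ω n)⁻¹ ≤ 1 := inv_le_one_of_one_le₀ (one_le_sqSum n)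

/-- A Christoffel–Darboux identity: multiplying the recurrence by `absPoly ω (n + 1)` adds exactly
one square to the sum. -/
theorem sqrt_mul_absPoly_mul_absPoly (hω : ∀ n, 1 ≤ n → 0 < ω n) (n : ℕ) :
    Real.sqrt (ω (n + 1)) * absPoly ω n * absPoly ω (n + 1) = sqSum ω n := by
  induction n with
  | zero =>
    have := sqrt_mul_absPoly_one hω
    simp only [absPoly, sqSum_zero, zero_add] at this ⊢
    linarith
  | succ n ih =>
    have := sqrt_mul_absPoly hω n
    rw [sqSum_succ, ← ih]
    linear_combination (absPoly ω (n + 1)) * this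

/-- Leibniz bounds for an alternating sum of decreasing positive terms. -/
theorem altSum_nonneg_and_le (d : ℕ) : ∀ n, 0 ≤ altSum ω d n ∧ altSum ω d n ≤ (sqSum ω n)⁻¹ := by
  induction d with
  | zero => exact fun n => ⟨le_rfl, (inv_pos.2 (sqSum_pos n)).le⟩
  | succ d ih =>
    intro n
    have h := sqSum_inv_anti (ω := ω) n.le_succ
    obtain ⟨h1, h2⟩ := ih (n + 1)
    rw [altSum]
    exact ⟨by linarith, by linarith⟩

theorem abs_altSum_le_one (d n : ℕ) : |altSum ω d n| ≤ 1 := by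
  obtain ⟨h1, h2⟩ := altSum_nonneg_and_le (ω := ω) d n
  rw [abs_of_nonneg h1]
  exact h2.trans (sqSum_inv_le_one n)

/-- `altSum` is defined by peeling off the first term; this describes the effect of appending a last
one. -/
theorem altSum_succ_sub (d : ℕ) :
    ∀ n, altSum ω (d + 1) n - altSum ω d n = (-1) ^ d * (sqSum ω (n + d))⁻¹ := by
  induction d with
  | zero => intro n; simp [altSum]
  | succ d ih =>
    intro n
    have := ih (n + 1)
    have h1 : altSum ω (d + 1 + 1) n = (sqSum ω n)⁻¹ - altSum ω (d + 1) (n + 1) := rfl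
    have h2 : altSum ω (d + 1) n = (sqSum ω n)⁻¹ - altSum ω d (n + 1) := rfl
    rw [h1, h2, show n + (d + 1) = n + 1 + d by ring, pow_succ]
    linear_combination -this

theorem altSum_even_mono : Monotone fun m => altSum ω (2 * m) 0 := by
  refine monotone_nat_of_le_succ fun m => ?_
  have h1 := altSum_succ_sub (ω := ω) (2 * m) 0
  have h2 := altSum_succ_sub (ω := ω) (2 * m + 1) 0
  have h3 := sqSum_inv_anti (ω := ω) (2 * m).le_succ
  rw [pow_succ] at h2
  simp only [zero_add, even_two, Even.mul_right, Even.neg_pow, one_pow, one_mul, mul_neg,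
    mul_one, neg_mul] at h1 h2
  simp only [mul_add, mul_one]
  simp only [Nat.succ_eq_add_one] at h3
  rw [show 2 * m + 2 = 2 * m + 1 + 1 from rfl]
  linarith

theorem exists_tendsto_altSum_even :
    ∃ t, Tendsto (fun m => altSum ω (2 * m) 0) atTop (𝓝 t) :=
  ⟨_, tendsto_atTop_ciSup altSum_even_mono
    ⟨1, by rintro _ ⟨m, rfl⟩; exact (le_abs_self _).trans (abs_altSum_le_one _ _)⟩⟩

theorem tendsto_sqSum_inv_of_bound {C : ℝ} (hC : ∀ n, sqSum ω n ≤ C) :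
    ∃ s, 0 < s ∧ Tendsto (fun m => (sqSum ω m)⁻¹) atTop (𝓝 s) := by
  have h := tendsto_atTop_ciSup (sqSum_mono (ω := ω)) ⟨C, by rintro _ ⟨m, rfl⟩; exact hC m⟩
  have hp : 0 < ⨆ n, sqSum ω n :=
    zero_lt_one.trans_le (ge_of_tendsto' h fun n => one_le_sqSum n)
  exact ⟨_, inv_pos.2 hp, h.inv₀ hp.ne'⟩

theorem tendsto_sqSum_inv_of_not_bound (hC : ¬ ∃ C, ∀ n, sqSum ω n ≤ C) :
    Tendsto (fun m => (sqSum ω m)⁻¹) atTop (𝓝 0) := by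
  refine tendsto_inv_atTop_zero.comp ((tendsto_atTop_atTop_of_monotone sqSum_mono) fun C => ?_)
  push Not at hC
  obtain ⟨n, hn⟩ := hC C
  exact ⟨n, hn.le⟩

theorem tendsto_altSum_odd_sub {s : ℝ} (h : Tendsto (fun m => (sqSum ω m)⁻¹) atTop (𝓝 s)) :
    Tendsto (fun m => altSum ω (2 * m + 1) 0 - altSum ω (2 * m) 0) atTop (𝓝 s) := by
  have h2 : Tendsto (fun m : ℕ => 2 * m) atTop atTop :=
    tendsto_id.const_mul_atTop' two_pos
  refine (h.comp h2).congr fun m => ?_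
  simp [altSum_succ_sub]

/-- Up to the leading coefficient, `B_n` is the orthonormal polynomial of degree `n + 1` at `i`; the
index is shifted by one because `B_{-1} = B_0 = 1`. -/
theorem seqB_eq (hω : ∀ n, 1 ≤ n → 0 < ω n) : ∀ n,
    seqB ω n = absPoly ω (n + 1) * ∏ k ∈ Finset.range (n + 1), Real.sqrt (ω (k + 1))
  | 0 => by
    have := sqrt_mul_absPoly_one hω
    simp only [absPoly] at this
    simp only [seqB, absPoly, zero_add, Finset.prod_range_one]
    linarith
  | 1 => by
    have h1 := sqrt_mul_absPoly_one hω
    have h2 := sqrt_mul_absPoly hω 0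
    have h3 := Real.sq_sqrt (hω 1 le_rfl).le
    simp only [absPoly.eq_1, zero_add] at h1 h2
    simp only [seqB, Finset.prod_range_succ, Finset.prod_range_zero, zero_add, one_mul,
      Nat.reduceAdd]
    linear_combination -h1 - h3 - Real.sqrt (ω 1) * h2
  | n + 2 => by
    have h1 := seqB_eq hω n
    have h2 := seqB_eq hω (n + 1)
    have h3 := sqrt_mul_absPoly hω (n + 1)
    have h4 := Real.sq_sqrt (hω (n + 2) (by omega)).le
    rw [seqB, h1, h2, ← h4]
    simp only [Finset.prod_range_succ _ (n + 1), Finset.prod_range_succ _ (n + 2)]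
    simp only [add_assoc, Nat.reduceAdd] at h3 ⊢
    linear_combination -(∏ k ∈ Finset.range (n + 1), Real.sqrt (ω (k + 1))) *
      Real.sqrt (ω (n + 2)) * h3

theorem seqB_div (hω : ∀ n, 1 ≤ n → 0 < ω n) (n : ℕ) :
    seqB ω n / seqB ω (n + 1) = absPoly ω (n + 1) ^ 2 / sqSum ω (n + 1) := by
  have h0 : (∏ k ∈ Finset.range (n + 1), Real.sqrt (ω (k + 1))) ≠ 0 :=
    Finset.prod_ne_zero_iff.2 fun k _ => (sqrt_jacobi_pos hω k).ne'
  have h1 := (absPoly_pos hω (n + 1)).ne'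
  have h2 := (absPoly_pos hω (n + 2)).ne'
  have h3 := (sqrt_jacobi_pos hω (n + 1)).ne'
  rw [seqB_eq hω, seqB_eq hω, Finset.prod_range_succ _ (n + 1),
    ← sqrt_mul_absPoly_mul_absPoly hω (n + 1)]
  simp only [add_assoc, Nat.reduceAdd] at *
  field_simp

theorem prod_one_sub_seqB_div (hω : ∀ n, 1 ≤ n → 0 < ω n) (m : ℕ) :
    ∏ n ∈ Finset.range m, (1 - seqB ω n / seqB ω (n + 1)) = (sqSum ω m)⁻¹ := by
  induction m with
  | zero => simp [sqSum_zero]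
  | succ m ih =>
    have h1 := (sqSum_pos (ω := ω) m).ne'
    have h2 := (sqSum_pos (ω := ω) (m + 1)).ne'
    have h3 := sqSum_succ (ω := ω) m
    rw [Finset.prod_range_succ, ih, seqB_div hω]
    field_simp
    linarith

/-- The Abel–Dini argument: the summands are `(S_{n+1} - S_n) / S_{n+1}`, so a tail below `1 / 2`
prevents `S` from more than doubling after `N`. -/
theorem sqSum_bound_of_sum (hω : ∀ n, 1 ≤ n → 0 < ω n) {S : ℝ}
    (h : Tendsto (fun m : ℕ => ∑ n ∈ Finset.range m, seqB ω n / seqB ω (n + 1)) atTop (𝓝 S)) :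
    ∃ C, ∀ n, sqSum ω n ≤ C := by
  obtain ⟨N, hN⟩ := Metric.cauchySeq_iff'.1 h.cauchySeq (1 / 2) (by norm_num)
  -- Replacing each denominator by the larger `sqSum ω (N + M)` makes the sum telescope; the case `d
  -- = M` is the one used.
  have key : ∀ d M, d ≤ M → 1 - sqSum ω N / sqSum ω (N + M) ≤
      1 - sqSum ω (N + d) / sqSum ω (N + M) +
      ((∑ n ∈ Finset.range (N + d), seqB ω n / seqB ω (n + 1)) -
        ∑ n ∈ Finset.range N, seqB ω n / seqB ω (n + 1)) := by
    intro d M hd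
    induction d with
    | zero => simp
    | succ d ih =>
      refine (ih (by omega)).trans ?_
      rw [← add_assoc, Finset.sum_range_succ, seqB_div hω]
      have hs : sqSum ω (N + d + 1) / sqSum ω (N + M) = sqSum ω (N + d) / sqSum ω (N + M) +
          absPoly ω (N + d + 1) ^ 2 / sqSum ω (N + M) := by rw [sqSum_succ, add_div]
      have : absPoly ω (N + d + 1) ^ 2 / sqSum ω (N + M) ≤
          absPoly ω (N + d + 1) ^ 2 / sqSum ω (N + d + 1) :=
        div_le_div_of_nonneg_left (sq_nonneg _) (sqSum_pos _) (sqSum_mono (by omega))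
      linarith
  refine ⟨2 * sqSum ω N, fun n => ?_⟩
  rcases le_total n N with hn | hn
  · have := sqSum_mono (ω := ω) hn
    linarith [sqSum_pos (ω := ω) N]
  · obtain ⟨M, rfl⟩ := Nat.exists_eq_add_of_le hn
    have h1 := key M M le_rfl
    have h2 := (abs_lt.1 (Real.dist_eq _ _ ▸ hN (N + M) (by omega))).2
    rw [div_self (sqSum_pos _).ne'] at h1
    have h3 : 1 / 2 ≤ sqSum ω N / sqSum ω (N + M) := by linarith
    rw [le_div_iff₀ (sqSum_pos _)] at h3
    linarith

theorem summable_absPoly_sq {C : ℝ} (hC : ∀ n, sqSum ω n ≤ C) :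
    Summable fun n => absPoly ω n ^ 2 :=
  summable_of_sum_range_le (c := C) (fun _ => sq_nonneg _) fun n =>
    (Finset.sum_le_sum_of_subset_of_nonneg (Finset.range_mono n.le_succ)
      fun _ _ _ => sq_nonneg _).trans (hC n)

end Sequences

/-- The orthonormal polynomials of `ω` at `i`. -/
noncomputable def polySol (ω : ℕ → ℝ) (n : ℕ) : ℂ := Complex.I ^ n * absPoly ω n

/-- A second solution of the recurrence of the orthonormal polynomials at `i`. -/
noncomputable def secondSol (ω t : ℕ → ℝ) (n : ℕ) : ℂ :=
  (-Complex.I) ^ (n + 1) * absPoly ω n * t n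

/-- The Green kernel of the Jacobi matrix at `i`. -/
noncomputable def greenKernel (ω t : ℕ → ℝ) (l k : ℕ) : ℂ :=
  polySol ω (min l k) * secondSol ω t (max l k)

/-- The weights `t` for which `greenKernel ω t` is the resolvent of the truncation to
`0, …, m`. -/
noncomputable def truncWeight (ω : ℕ → ℝ) (m n : ℕ) : ℝ := altSum ω (m + 1 - n) n

/-! ### The Green kernel and the truncated resolvents -/

section Kernel

variable {ω t : ℕ → ℝ}

theorem greenKernel_comm (l k : ℕ) : greenKernel ω t l k = greenKernel ω t k l := by
  rw [greenKernel, greenKernel, min_comm, max_comm]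

theorem jacobiAction_polySol (hω : ∀ n, 1 ≤ n → 0 < ω n) (n : ℕ) :
    jacobiAction ω (polySol ω) n = Complex.I * polySol ω n := by
  cases n with
  | zero =>
    have h : ((Real.sqrt (ω 1) : ℂ)) * absPoly ω 1 = absPoly ω 0 := by
      exact_mod_cast sqrt_mul_absPoly_one hω
    simp only [jacobiAction, polySol]
    linear_combination Complex.I * h
  | succ n =>
    have h : ((Real.sqrt (ω (n + 2)) : ℂ)) * absPoly ω (n + 2) =
        absPoly ω (n + 1) + (Real.sqrt (ω (n + 1)) : ℂ) * absPoly ω n := by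
      exact_mod_cast sqrt_mul_absPoly hω n
    simp only [jacobiAction, polySol, pow_succ]
    linear_combination Complex.I ^ n * Complex.I * Complex.I * h +
      Complex.I ^ n * (Real.sqrt (ω (n + 1)) : ℂ) * absPoly ω n * Complex.I_mul_I

/-- Only rows `n + 1` occur: row `0` is where the second solution differs from a multiple of
`polySol`. -/
theorem jacobiAction_secondSol (hω : ∀ n, 1 ≤ n → 0 < ω n) (n : ℕ)
    (h0 : t n + t (n + 1) = (sqSum ω n)⁻¹)
    (h1 : t (n + 1) + t (n + 2) = (sqSum ω (n + 1))⁻¹) :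
    jacobiAction ω (secondSol ω t) (n + 1) = Complex.I * secondSol ω t (n + 1) := by
  have e0 := sqrt_mul_absPoly_mul_absPoly hω n
  have e1 := sqrt_mul_absPoly_mul_absPoly hω (n + 1)
  have e2 := sqrt_mul_absPoly hω n
  have hr : Real.sqrt (ω (n + 1)) * absPoly ω n * t n -
      Real.sqrt (ω (n + 2)) * absPoly ω (n + 2) * t (n + 2) =
      absPoly ω (n + 1) * t (n + 1) := by
    have f0 : Real.sqrt (ω (n + 1)) * absPoly ω n * (t n + t (n + 1)) =
        (absPoly ω (n + 1))⁻¹ := by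
      rw [h0, ← e0]
      have := (absPoly_pos hω n).ne'
      have := (sqrt_jacobi_pos hω n).ne'
      field_simp
    have f1 : Real.sqrt (ω (n + 2)) * absPoly ω (n + 2) * (t (n + 1) + t (n + 2)) =
        (absPoly ω (n + 1))⁻¹ := by
      rw [h1, ← e1]
      have := (absPoly_pos hω (n + 2)).ne'
      have := (sqrt_jacobi_pos hω (n + 1)).ne'
      simp only [add_assoc, Nat.reduceAdd] at *
      field_simp
    linear_combination f0 - f1 + t (n + 1) * e2
  have hc : (Real.sqrt (ω (n + 1)) : ℂ) * absPoly ω n * t n -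
      Real.sqrt (ω (n + 2)) * absPoly ω (n + 2) * t (n + 2) =
      absPoly ω (n + 1) * t (n + 1) := by exact_mod_cast hr
  simp only [jacobiAction, secondSol, pow_succ]
  linear_combination (-Complex.I) ^ n * (-Complex.I) * hc -
    (-Complex.I) ^ n * Complex.I * (Real.sqrt (ω (n + 2)) * absPoly ω (n + 2) * t (n + 2) +
      absPoly ω (n + 1) * t (n + 1)) * Complex.I_mul_I

theorem wronskian (hω : ∀ n, 1 ≤ n → 0 < ω n) (n : ℕ)
    (h0 : t n + t (n + 1) = (sqSum ω n)⁻¹) :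
    (Real.sqrt (ω (n + 1)) : ℂ) * (polySol ω (n + 1) * secondSol ω t n -
      polySol ω n * secondSol ω t (n + 1)) = 1 := by
  have hr : Real.sqrt (ω (n + 1)) * absPoly ω n * absPoly ω (n + 1) * (t n + t (n + 1)) = 1 := by
    rw [h0, sqrt_mul_absPoly_mul_absPoly hω, mul_inv_cancel₀ (sqSum_pos n).ne']
  have hc : (Real.sqrt (ω (n + 1)) : ℂ) * absPoly ω n * absPoly ω (n + 1) * (t n + t (n + 1)) = 1 :=
    by exact_mod_cast hr
  have hi : Complex.I ^ n * (-Complex.I) ^ n = 1 := by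
    rw [← mul_pow, mul_neg, Complex.I_mul_I, neg_neg, one_pow]
  simp only [polySol, secondSol, pow_succ]
  linear_combination hc + (Real.sqrt (ω (n + 1)) : ℂ) * absPoly ω n * absPoly ω (n + 1) *
    (t n + t (n + 1)) * hi - (Real.sqrt (ω (n + 1)) : ℂ) * absPoly ω n * absPoly ω (n + 1) *
    Complex.I ^ n * (-Complex.I) ^ n * (t n + t (n + 1)) * Complex.I_mul_I

theorem jacobiAction_congr {v w : ℕ → ℂ} (n : ℕ) (h : ∀ j ≤ n + 1, n ≤ j + 1 → v j = w j) :
    jacobiAction ω v n = jacobiAction ω w n := by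
  cases n with
  | zero => simp only [jacobiAction, h 1 (by omega) (by omega)]
  | succ n => simp only [jacobiAction, h n (by omega) (by omega), h (n + 2) (by omega) (by omega)]

/-- Off the diagonal, row `l` sees just one of the two solutions, and each solves the recurrence
there. On the diagonal the mismatch between them is the Wronskian, which is `1`. -/
theorem jacobiAction_greenKernel (hω : ∀ n, 1 ≤ n → 0 < ω n) (l k : ℕ)
    (h : ∀ j ≤ l, t j + t (j + 1) = (sqSum ω j)⁻¹) :
    jacobiAction ω (fun j => greenKernel ω t j k) l =
      Complex.I * greenKernel ω t l k - if l = k then 1 else 0 := by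
  have hsmul : ∀ (c : ℂ) (v : ℕ → ℂ) n, jacobiAction ω (fun j => c * v j) n =
      c * jacobiAction ω v n := fun c v n => congrFun (jacobiAction_smul ω c v) n
  rcases lt_trichotomy l k with hlk | rfl | hlk
  · rw [jacobiAction_congr (w := fun j => secondSol ω t k * polySol ω j), hsmul,
      jacobiAction_polySol hω, greenKernel, min_eq_left hlk.le, max_eq_right hlk.le, if_neg hlk.ne]
    · ring
    · intro j hj _
      simp only [greenKernel]
      rw [min_eq_left (by omega), max_eq_right (by omega), mul_comm]
  · have hw := wronskian hω l (h l le_rfl)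
    have hp := jacobiAction_polySol hω l
    cases l with
    | zero =>
      simp only [jacobiAction, greenKernel, zero_add] at hw hp ⊢
      simp only [min_self, max_self, zero_le, min_eq_right, max_eq_left, if_true]
      linear_combination secondSol ω t 0 * hp - hw
    | succ l =>
      simp only [jacobiAction, greenKernel, add_assoc, Nat.reduceAdd] at hw hp ⊢
      rw [min_self, max_self, min_eq_left (by omega), max_eq_right (by omega),
        min_eq_right (by omega), max_eq_left (by omega), if_pos trivial]
      linear_combination secondSol ω t (l + 1) * hp - hw
  · obtain ⟨n, rfl⟩ : ∃ n, l = n + 1 := ⟨l - 1, by omega⟩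
    rw [jacobiAction_congr (w := fun j => polySol ω k * secondSol ω t j), hsmul,
      jacobiAction_secondSol hω n (h n (by omega)) (h (n + 1) le_rfl), greenKernel,
      min_eq_right hlk.le, max_eq_left hlk.le, if_neg hlk.ne']
    · ring
    · intro j _ hj
      simp only [greenKernel]
      rw [min_eq_right (by omega), max_eq_left (by omega)]

theorem norm_greenKernel_le (hω : ∀ n, 1 ≤ n → 0 < ω n) (ht : ∀ n, |t n| ≤ 1) (l k : ℕ) :
    ‖greenKernel ω t l k‖ ≤ absPoly ω l * absPoly ω k := by
  have h : ‖greenKernel ω t l k‖ =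
      absPoly ω (min l k) * absPoly ω (max l k) * |t (max l k)| := by
    simp [greenKernel, polySol, secondSol, abs_of_pos (absPoly_pos hω _), mul_assoc]
  have h2 : absPoly ω (min l k) * absPoly ω (max l k) = absPoly ω l * absPoly ω k := by
    rcases le_total l k with h | h <;> simp [h, mul_comm]
  rw [h, h2]
  exact mul_le_of_le_one_right (mul_pos (absPoly_pos hω l) (absPoly_pos hω k)).le (ht _)

theorem truncWeight_of_lt {m n : ℕ} (h : m < n) : truncWeight ω m n = 0 := by
  rw [truncWeight, show m + 1 - n = 0 by omega, altSum]

theorem truncWeight_add {m n : ℕ} (h : n ≤ m) :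
    truncWeight ω m n + truncWeight ω m (n + 1) = (sqSum ω n)⁻¹ := by
  rw [truncWeight, truncWeight, show m + 1 - n = (m - n) + 1 by omega,
    show m + 1 - (n + 1) = m - n by omega, altSum]
  ring

theorem abs_truncWeight_le_one (m n : ℕ) : |truncWeight ω m n| ≤ 1 := abs_altSum_le_one _ _

theorem greenKernel_truncWeight_of_lt_left {m l k : ℕ} (h : m < l) :
    greenKernel ω (truncWeight ω m) l k = 0 := by
  simp [greenKernel, secondSol, truncWeight_of_lt (lt_max_of_lt_left h)]

theorem greenKernel_truncWeight_of_lt_right {m l k : ℕ} (h : m < k) :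
    greenKernel ω (truncWeight ω m) l k = 0 := by
  rw [greenKernel_comm, greenKernel_truncWeight_of_lt_left h]

/-- The truncation only loses the neighbour `m + 1` of the last row, which `hv` makes harmless. -/
theorem truncMatrix_mul_col (v : ℕ → ℂ) {m : ℕ} (hv : v (m + 1) = 0) (l : Fin (m + 1)) :
    ∑ k : Fin (m + 1), truncMatrix ω m l k * v k = jacobiAction ω v l := by
  obtain ⟨l, hl⟩ := l
  have h : ∀ k : Fin (m + 1), truncMatrix ω m ⟨l, hl⟩ k * v k =
      (fun k : ℕ => (if l + 1 = k then (Real.sqrt (ω k) : ℂ) * v k else 0) +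
        if k + 1 = l then (Real.sqrt (ω l) : ℂ) * v k else 0) k := by
    intro k
    simp only [truncMatrix, Matrix.of_apply]
    split_ifs <;> first | omega | simp
  rw [Finset.sum_congr rfl fun k _ => h k, Fin.sum_univ_eq_sum_range
    (fun k : ℕ => (if l + 1 = k then (Real.sqrt (ω k) : ℂ) * v k else 0) +
      if k + 1 = l then (Real.sqrt (ω l) : ℂ) * v k else 0), Finset.sum_add_distrib,
    Finset.sum_ite_eq]
  have h1 : (if l + 1 ∈ Finset.range (m + 1) then (Real.sqrt (ω (l + 1)) : ℂ) * v (l + 1) else 0) =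
      (Real.sqrt (ω (l + 1)) : ℂ) * v (l + 1) := by
    split_ifs with h
    · rfl
    · rw [Finset.mem_range] at h
      rw [show l + 1 = m + 1 by omega, hv, mul_zero]
  rw [h1]
  cases l with
  | zero => simp [jacobiAction]
  | succ n =>
    simp only [jacobiAction, Nat.add_right_cancel_iff, Finset.sum_ite_eq', Finset.mem_range]
    rw [if_pos (by omega), add_comm]

theorem truncResolventMatrix_apply (hω : ∀ n, 1 ≤ n → 0 < ω n) (m : ℕ) (l k : Fin (m + 1)) :
    truncResolventMatrix ω m l k = greenKernel ω (truncWeight ω m) l k := by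
  have h : (Complex.I • (1 : Matrix (Fin (m + 1)) (Fin (m + 1)) ℂ) - truncMatrix ω m) *
      Matrix.of (fun l k : Fin (m + 1) => greenKernel ω (truncWeight ω m) l k) = 1 := by
    ext l k
    rw [sub_mul, smul_mul_assoc, one_mul, Matrix.sub_apply, Matrix.mul_apply, Matrix.smul_apply]
    simp only [Matrix.of_apply, smul_eq_mul]
    rw [truncMatrix_mul_col (fun j => greenKernel ω (truncWeight ω m) j k)
      (greenKernel_truncWeight_of_lt_left (by omega)),
      jacobiAction_greenKernel hω _ _ fun j hj => truncWeight_add (by omega), Matrix.one_apply]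
    simp [Fin.ext_iff]
  rw [truncResolventMatrix, Matrix.inv_eq_right_inv h, Matrix.of_apply]

theorem truncStieltjes_eq (hω : ∀ n, 1 ≤ n → 0 < ω n) (m : ℕ) :
    truncStieltjes ω m = -Complex.I * altSum ω (m + 1) 0 := by
  rw [truncStieltjes, truncResolventMatrix_apply hω]
  simp [greenKernel, polySol, secondSol, truncWeight, absPoly]

theorem delta_apply (k l : ℕ) : (delta k : ℕ → ℂ) l = if l = k then 1 else 0 := by
  simp [delta, lp.single_apply, Pi.single_apply]

theorem inner_delta (k : ℕ) (ξ : EllTwo) : inner ℂ (delta k) ξ = ξ k := by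
  simp [delta, lp.inner_single_left]

theorem truncResolvent_apply (hω : ∀ n, 1 ≤ n → 0 < ω n) (m : ℕ) (ξ : EllTwo) (l : ℕ) :
    truncResolvent ω m ξ l =
      ∑ k ∈ Finset.range (m + 1), greenKernel ω (truncWeight ω m) l k * ξ k := by
  have h : truncResolvent ω m ξ l = ∑ j : Fin (m + 1), ∑ k : Fin (m + 1),
      greenKernel ω (truncWeight ω m) j k * (ξ k * (delta j : ℕ → ℂ) l) := by
    simp only [truncResolvent, truncResolventMatrix_apply hω, sum_apply,
      lp.coeFn_sum, Finset.sum_apply, _root_.smul_apply, lp.coeFn_smul, Pi.smul_apply,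
      ContinuousLinearMap.smulRight_apply, innerSL_apply_apply, inner_delta, smul_eq_mul]
  rw [h, Fin.sum_univ_eq_sum_range (fun j => ∑ k : Fin (m + 1),
      greenKernel ω (truncWeight ω m) j k * (ξ k * (delta j : ℕ → ℂ) l)) (m + 1)]
  by_cases hl : l ∈ Finset.range (m + 1)
  · rw [Finset.sum_eq_single_of_mem l hl]
    · rw [Fin.sum_univ_eq_sum_range (fun k =>
        greenKernel ω (truncWeight ω m) l k * (ξ k * (delta l : ℕ → ℂ) l))]
      simp [delta_apply]
    · intro j _ hj
      simp [delta_apply, hj.symm]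
  · rw [Finset.sum_eq_zero, Finset.sum_eq_zero]
    · intro k _
      rw [greenKernel_truncWeight_of_lt_left (by simpa using hl), zero_mul]
    · intro j hj
      have : l ≠ j := fun e => hl (e ▸ hj)
      simp [delta_apply, this]

end Kernel

/-! ### Strong limits of the truncated resolvents -/

section Limit

variable {ω : ℕ → ℝ}

theorem exists_lp_tendsto_of_dominated {f : ℕ → EllTwo} {g : ℕ → ℂ} {h : ℕ → ℝ}
    (hh : Summable fun l => h l ^ 2) (hb : ∀ m l, ‖f m l‖ ≤ h l)
    (hl : ∀ l, Tendsto (fun m => f m l) atTop (𝓝 (g l))) :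
    ∃ G : EllTwo, (G : ℕ → ℂ) = g ∧ Tendsto f atTop (𝓝 G) := by
  have hg : ∀ l, ‖g l‖ ≤ h l := fun l => le_of_tendsto' (hl l).norm fun m => hb m l
  have hmem : Memℓp (E := fun _ : ℕ => ℂ) g 2 := by
    refine memℓp_gen ?_
    simp only [ENNReal.toReal_ofNat, Real.rpow_ofNat]
    exact hh.of_nonneg_of_le (fun l => by positivity) fun l =>
      pow_le_pow_left₀ (norm_nonneg _) (hg l) 2
  refine ⟨⟨g, hmem⟩, rfl, ?_⟩
  rw [tendsto_iff_norm_sub_tendsto_zero]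
  have hsq : ∀ m, ‖f m - ⟨g, hmem⟩‖ ^ 2 = ∑' l, ‖f m l - g l‖ ^ 2 := by
    intro m
    have := lp.norm_rpow_eq_tsum (p := 2) (by norm_num) (f m - ⟨g, hmem⟩)
    simp only [ENNReal.toReal_ofNat, Real.rpow_ofNat] at this
    exact this
  have h0 : Tendsto (fun m => ‖f m - ⟨g, hmem⟩‖ ^ 2) atTop (𝓝 0) := by
    simp only [hsq]
    have := tendsto_tsum_of_dominated_convergence (𝓕 := atTop)
      (f := fun m l => ‖f m l - g l‖ ^ 2) (g := fun _ => (0 : ℝ))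
      -- Both `f m l` and `g l` are bounded by `h l`, so their difference is at most `2 * h l`.
      (bound := fun l => 4 * h l ^ 2) (hh.mul_left 4) (fun l => ?_) (Eventually.of_forall ?_)
    · simpa using this
    · have := ((hl l).sub_const (g l)).norm.pow 2
      simpa using this
    · intro m l
      have h1 : ‖f m l - g l‖ ≤ 2 * h l :=
        (norm_sub_le _ _).trans (by linarith [hb m l, hg l])
      rw [Real.norm_of_nonneg (by positivity)]
      nlinarith [norm_nonneg (f m l - g l)]
  have h1 := h0.sqrt
  simpa [Real.sqrt_sq (norm_nonneg _)] using h1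

theorem tendsto_apply {f : ℕ → EllTwo} {G : EllTwo} (h : Tendsto f atTop (𝓝 G)) (l : ℕ) :
    Tendsto (fun m => f m l) atTop (𝓝 (G l)) := by
  simpa only [inner_delta] using (tendsto_const_nhds (x := delta l)).inner (𝕜 := ℂ) h

/-- Consecutive weights add up to `(sqSum ω n)⁻¹`, so convergence at `n = 0` propagates to every
`n`. -/
theorem exists_tendsto_truncWeight {σ : ℕ → ℕ} (hσ : Tendsto σ atTop atTop) {t₀ : ℝ}
    (h : Tendsto (fun m => altSum ω (σ m + 1) 0) atTop (𝓝 t₀)) (n : ℕ) :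
    ∃ t, Tendsto (fun m => truncWeight ω (σ m) n) atTop (𝓝 t) := by
  induction n with
  | zero => exact ⟨t₀, h⟩
  | succ n ih =>
    obtain ⟨t, ht⟩ := ih
    refine ⟨(sqSum ω n)⁻¹ - t, (ht.const_sub _).congr' ?_⟩
    filter_upwards [hσ.eventually_ge_atTop n] with m hm
    linarith [truncWeight_add (ω := ω) hm]

theorem summable_absPoly_mul_norm (hb : Summable fun n => absPoly ω n ^ 2) (ξ : EllTwo) :
    Summable fun k => absPoly ω k * ‖ξ k‖ := by
  have h2 : Summable fun k => ‖ξ k‖ ^ 2 := by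
    simpa only [ENNReal.toReal_ofNat, Real.rpow_ofNat] using
      (lp.memℓp ξ).summable (p := 2) (by norm_num)
  refine Summable.of_norm_bounded (hb.add h2) fun k => ?_
  rw [Real.norm_eq_abs, abs_le]
  constructor <;> nlinarith [sq_nonneg (absPoly ω k - ‖ξ k‖), sq_nonneg (absPoly ω k + ‖ξ k‖),
    sq_nonneg (absPoly ω k), sq_nonneg (‖ξ k‖)]

theorem exists_strongLimit (hω : ∀ n, 1 ≤ n → 0 < ω n) (hb : Summable fun n => absPoly ω n ^ 2)
    {σ : ℕ → ℕ} (hσ : Tendsto σ atTop atTop) {t₀ : ℝ}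
    (h : Tendsto (fun m => altSum ω (σ m + 1) 0) atTop (𝓝 t₀)) :
    ∃ Y : EllTwo →L[ℂ] EllTwo, IsStrongLimit (fun m => truncResolvent ω (σ m)) Y := by
  choose t ht using exists_tendsto_truncWeight hσ h
  have key : ∀ ξ, ∃ G, Tendsto (fun m => truncResolvent ω (σ m) ξ) atTop (𝓝 G) := by
    intro ξ
    have hs := summable_absPoly_mul_norm hb ξ
    have hterm : ∀ m l k, ‖greenKernel ω (truncWeight ω m) l k * ξ k‖ ≤
        absPoly ω l * (absPoly ω k * ‖ξ k‖) := fun m l k => by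
      rw [norm_mul, ← mul_assoc]
      exact mul_le_mul_of_nonneg_right
        (norm_greenKernel_le hω (abs_truncWeight_le_one m) l k) (norm_nonneg _)
    have heq : ∀ m l, truncResolvent ω m ξ l =
        ∑' k, greenKernel ω (truncWeight ω m) l k * ξ k := fun m l => by
      rw [truncResolvent_apply hω, tsum_eq_sum]
      intro k hk
      rw [greenKernel_truncWeight_of_lt_right (by simpa using hk), zero_mul]
    have hsq : Summable fun l => (absPoly ω l * ∑' k, absPoly ω k * ‖ξ k‖) ^ 2 :=
      (hb.mul_right _).congr fun l => (mul_pow _ _ _).symm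
    have hbound : ∀ m l, ‖truncResolvent ω (σ m) ξ l‖ ≤
        absPoly ω l * ∑' k, absPoly ω k * ‖ξ k‖ := fun m l => by
      rw [heq, ← tsum_mul_left]
      exact tsum_of_norm_bounded (hs.mul_left _).hasSum (hterm _ l)
    have hlim : ∀ l, Tendsto (fun m => truncResolvent ω (σ m) ξ l) atTop
        (𝓝 (∑' k, greenKernel ω t l k * ξ k)) := fun l => by
      simp only [heq]
      refine tendsto_tsum_of_dominated_convergence (hs.mul_left (absPoly ω l)) (fun k => ?_)
        (Eventually.of_forall fun m k => hterm _ l k)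
      have h1 : Tendsto (fun m => ((truncWeight ω (σ m) (max l k) : ℝ) : ℂ)) atTop
          (𝓝 (t (max l k) : ℂ)) := (Complex.continuous_ofReal.tendsto _).comp (ht _)
      simpa only [greenKernel, secondSol] using
        ((h1.const_mul _).const_mul (polySol ω (min l k))).mul_const (ξ k)
    obtain ⟨G, -, hG⟩ := exists_lp_tendsto_of_dominated hsq hbound hlim
    exact ⟨G, hG⟩
  choose G hG using key
  exact ⟨continuousLinearMapOfTendsto (fun m => truncResolvent ω (σ m)) (f := G)
    (tendsto_pi_nhds.2 hG), hG⟩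

theorem jacobiAction_sum {ι : Type*} (s : Finset ι) (f : ι → ℕ → ℂ) (n : ℕ) :
    jacobiAction ω (fun l => ∑ k ∈ s, f k l) n = ∑ k ∈ s, jacobiAction ω (f k) n := by
  cases n <;> simp only [jacobiAction, Finset.mul_sum, Finset.sum_add_distrib]

theorem jacobiAction_star (v : ℕ → ℂ) (n : ℕ) :
    jacobiAction ω (fun k => star (v k)) n = star (jacobiAction ω v n) := by
  cases n <;> simp [jacobiAction]

theorem truncResolvent_apply_of_lt (hω : ∀ n, 1 ≤ n → 0 < ω n) {m l : ℕ} (h : m < l)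
    (ξ : EllTwo) : truncResolvent ω m ξ l = 0 := by
  rw [truncResolvent_apply hω]
  exact Finset.sum_eq_zero fun k _ => by rw [greenKernel_truncWeight_of_lt_left h, zero_mul]

theorem jacobiAction_truncResolvent (hω : ∀ n, 1 ≤ n → 0 < ω n) {m l : ℕ} (h : l ≤ m)
    (ξ : EllTwo) :
    jacobiAction ω (truncResolvent ω m ξ) l = Complex.I * truncResolvent ω m ξ l - ξ l := by
  have h1 : (truncResolvent ω m ξ : ℕ → ℂ) = fun l =>
      ∑ k ∈ Finset.range (m + 1), ξ k * greenKernel ω (truncWeight ω m) l k := by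
    funext l
    rw [truncResolvent_apply hω]
    exact Finset.sum_congr rfl fun k _ => mul_comm _ _
  rw [h1, jacobiAction_sum, Finset.mul_sum]
  have h2 : ∀ k, jacobiAction ω (fun l => ξ k * greenKernel ω (truncWeight ω m) l k) l =
      Complex.I * (ξ k * greenKernel ω (truncWeight ω m) l k) - if l = k then ξ k else 0 := by
    intro k
    have := congrFun (jacobiAction_smul ω (ξ k) fun l => greenKernel ω (truncWeight ω m) l k) l
    rw [Pi.smul_apply, jacobiAction_greenKernel hω _ _ fun j hj => truncWeight_add (hj.trans h)]
      at this
    refine Eq.trans this ?_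
    split_ifs <;> simp only [smul_eq_mul] <;> ring
  simp only [h2, Finset.sum_sub_distrib]
  rw [Finset.sum_ite_eq, if_pos (by simpa using Nat.lt_succ_of_le h)]

/-- The discrete Green formula. Every later symmetry statement comes from the vanishing of its
boundary term. -/
theorem sum_mul_jacobiAction_sub (u v : ℕ → ℂ) (n : ℕ) :
    ∑ k ∈ Finset.range (n + 1), u k * jacobiAction ω v k -
      ∑ k ∈ Finset.range (n + 1), jacobiAction ω u k * v k =
      Real.sqrt (ω (n + 1)) * (u n * v (n + 1) - u (n + 1) * v n) := by
  induction n with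
  | zero => simp [jacobiAction]; ring
  | succ n ih =>
    rw [Finset.sum_range_succ, Finset.sum_range_succ _ (n + 1)]
    simp only [jacobiAction, add_assoc, Nat.reduceAdd] at ih ⊢
    linear_combination ih

theorem inner_eq_sum_of_left {x : EllTwo} {n : ℕ} (hx : ∀ k, n ≤ k → x k = 0) (y : EllTwo) :
    inner ℂ x y = ∑ k ∈ Finset.range n, star (x k) * y k := by
  rw [lp.inner_eq_tsum, tsum_eq_sum (s := Finset.range n)]
  · exact Finset.sum_congr rfl fun k _ => by simp [mul_comm]
  · intro k hk
    simp [hx k (by simpa using hk)]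

theorem inner_eq_sum_of_right {y : EllTwo} {n : ℕ} (hy : ∀ k, n ≤ k → y k = 0) (x : EllTwo) :
    inner ℂ x y = ∑ k ∈ Finset.range n, star (x k) * y k := by
  rw [lp.inner_eq_tsum, tsum_eq_sum (s := Finset.range n)]
  · exact Finset.sum_congr rfl fun k _ => by simp [mul_comm]
  · intro k hk
    simp [hy k (by simpa using hk)]

theorem inner_star_left (x y : EllTwo) : inner ℂ (star x) y = inner ℂ (star y) x := by
  simp only [lp.inner_eq_tsum, lp.star_apply]
  exact tsum_congr fun k => by simp [mul_comm]

theorem truncResolvent_inner_sub (hω : ∀ n, 1 ≤ n → 0 < ω n) (m : ℕ) (ξ η : EllTwo) :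
    inner ℂ (truncResolvent ω m ξ) η - inner ℂ ξ (truncResolvent ω m η) =
      2 * Complex.I * inner ℂ (truncResolvent ω m ξ) (truncResolvent ω m η) := by
  have h0 : ∀ ζ k, m + 1 ≤ k → truncResolvent ω m ζ k = 0 := fun ζ k hk =>
    truncResolvent_apply_of_lt hω hk ζ
  rw [inner_eq_sum_of_left (h0 ξ), inner_eq_sum_of_right (h0 η), inner_eq_sum_of_right (h0 η)]
  have h := sum_mul_jacobiAction_sub (ω := ω) (fun k => star (truncResolvent ω m ξ k))
    (truncResolvent ω m η) m
  simp only [jacobiAction_star, h0 _ (m + 1) le_rfl] at h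
  have e1 : ∑ k ∈ Finset.range (m + 1), star (truncResolvent ω m ξ k) *
      jacobiAction ω (truncResolvent ω m η) k = ∑ k ∈ Finset.range (m + 1),
        (Complex.I * (star (truncResolvent ω m ξ k) * truncResolvent ω m η k) -
          star (truncResolvent ω m ξ k) * η k) :=
    Finset.sum_congr rfl fun k hk => by
      rw [jacobiAction_truncResolvent hω (Finset.mem_range_succ_iff.1 hk)]; ring
  have e2 : ∑ k ∈ Finset.range (m + 1), star (jacobiAction ω (truncResolvent ω m ξ) k) *
      truncResolvent ω m η k = ∑ k ∈ Finset.range (m + 1),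
        (-(Complex.I * (star (truncResolvent ω m ξ k) * truncResolvent ω m η k)) -
          star (ξ k) * truncResolvent ω m η k) :=
    Finset.sum_congr rfl fun k hk => by
      rw [jacobiAction_truncResolvent hω (Finset.mem_range_succ_iff.1 hk)]
      simp only [star_sub, star_mul, RCLike.star_def, Complex.conj_I]
      ring
  rw [e1, e2, Finset.sum_sub_distrib, Finset.sum_sub_distrib, Finset.sum_neg_distrib,
    ← Finset.mul_sum, star_zero] at h
  linear_combination -h

theorem truncResolvent_inner_star (hω : ∀ n, 1 ≤ n → 0 < ω n) (m : ℕ) (ξ η : EllTwo) :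
    inner ℂ (star η) (truncResolvent ω m ξ) = inner ℂ (star ξ) (truncResolvent ω m η) := by
  have h0 : ∀ ζ k, m + 1 ≤ k → truncResolvent ω m ζ k = 0 := fun ζ k hk =>
    truncResolvent_apply_of_lt hω hk ζ
  rw [inner_eq_sum_of_right (h0 ξ), inner_eq_sum_of_right (h0 η)]
  simp only [lp.star_apply, star_star]
  have h := sum_mul_jacobiAction_sub (ω := ω) (truncResolvent ω m ξ) (truncResolvent ω m η) m
  rw [h0 _ (m + 1) le_rfl, h0 _ (m + 1) le_rfl, ← Finset.sum_sub_distrib] at h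
  rw [← sub_eq_zero, ← Finset.sum_sub_distrib]
  rw [← neg_eq_zero, ← Finset.sum_neg_distrib]
  refine Eq.trans (Finset.sum_congr rfl fun k hk => ?_) (h.trans (by ring))
  rw [jacobiAction_truncResolvent hω (Finset.mem_range_succ_iff.1 hk),
    jacobiAction_truncResolvent hω (Finset.mem_range_succ_iff.1 hk)]
  ring

/-- The relations that a limit of the operators `truncResolvent ω m` inherits from them. -/
structure IsLimitResolvent (ω : ℕ → ℝ) (Y : EllTwo →L[ℂ] EllTwo) : Prop where
  jacobiAction_apply : ∀ ξ l, jacobiAction ω (Y ξ) l = Complex.I * Y ξ l - ξ l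
  inner_sub : ∀ ξ η, inner ℂ (Y ξ) η - inner ℂ ξ (Y η) = 2 * Complex.I * inner ℂ (Y ξ) (Y η)
  inner_star : ∀ ξ η, inner ℂ (star η) (Y ξ) = inner ℂ (star ξ) (Y η)

theorem IsStrongLimit.isLimitResolvent (hω : ∀ n, 1 ≤ n → 0 < ω n) {σ : ℕ → ℕ}
    (hσ : Tendsto σ atTop atTop) {Y : EllTwo →L[ℂ] EllTwo}
    (hY : IsStrongLimit (fun m => truncResolvent ω (σ m)) Y) : IsLimitResolvent ω Y where
  jacobiAction_apply ξ l := by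
    have h1 : Tendsto (fun m => jacobiAction ω (truncResolvent ω (σ m) ξ) l) atTop
        (𝓝 (jacobiAction ω (Y ξ) l)) := by
      have := fun l => tendsto_apply (hY ξ) l
      cases l with
      | zero => exact (this 1).const_mul _
      | succ n => exact ((this n).const_mul _).add ((this (n + 2)).const_mul _)
    have h2 := ((tendsto_apply (hY ξ) l).const_mul Complex.I).sub_const (ξ l)
    refine tendsto_nhds_unique_of_eventuallyEq h1 h2 ?_
    filter_upwards [hσ.eventually_ge_atTop l] with m hm
    exact jacobiAction_truncResolvent hω hm ξ
  inner_sub ξ η :=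
    tendsto_nhds_unique_of_eventuallyEq
      (((hY ξ).inner tendsto_const_nhds).sub (tendsto_const_nhds.inner (hY η)))
      (((hY ξ).inner (hY η)).const_mul (2 * Complex.I))
      (Eventually.of_forall fun m => truncResolvent_inner_sub hω (σ m) ξ η)
  inner_star ξ η :=
    tendsto_nhds_unique_of_eventuallyEq (tendsto_const_nhds.inner (hY ξ))
      (tendsto_const_nhds.inner (hY η))
      (Eventually.of_forall fun m => truncResolvent_inner_star hω (σ m) ξ η)

end Limit

/-! ### From the limit resolvent to a self-adjoint extension -/

section Operators

variable {ω : ℕ → ℝ}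

theorem delta_mem_finSupp (k : ℕ) : delta k ∈ finSupp := by
  refine (Set.finite_singleton k).subset fun l hl => ?_
  by_contra h
  exact hl ((delta_apply k l).trans (if_neg h))

theorem dense_finSupp : Dense (finSupp : Set EllTwo) := by
  intro ξ
  have h := lp.hasSum_single (p := 2) (by norm_num) ξ
  refine mem_closure_of_tendsto h (Eventually.of_forall fun s => ?_)
  refine Submodule.sum_mem _ fun k _ => ?_
  have : lp.single 2 k (ξ k) = ξ k • delta k := by
    rw [delta, ← lp.single_smul, smul_eq_mul, mul_one]
  rw [this]
  exact Submodule.smul_mem _ _ (delta_mem_finSupp k)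

theorem exists_apply_eq_zero_of_mem_finSupp {x : EllTwo} (hx : x ∈ finSupp) :
    ∃ N, ∀ k, N ≤ k → x k = 0 := by
  obtain ⟨N, hN⟩ := Set.Finite.bddAbove hx
  refine ⟨N + 1, fun k hk => ?_⟩
  by_contra h
  exact absurd (hN h) (by omega)

theorem jacobiOp_apply (x : (jacobiOp ω).domain) (n : ℕ) :
    jacobiOp ω x n = jacobiAction ω (x : EllTwo) n := rfl

theorem jacobiAction_eq_zero {v : ℕ → ℂ} {N n : ℕ} (hv : ∀ k, N ≤ k → v k = 0) (hn : N + 1 ≤ n) :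
    jacobiAction ω v n = 0 := by
  obtain ⟨n, rfl⟩ : ∃ k, n = k + 1 := ⟨n - 1, by omega⟩
  simp [jacobiAction, hv n (by omega), hv (n + 2) (by omega)]

theorem inner_jacobiOp {y w : EllTwo} (hw : ∀ n, w n = jacobiAction ω y n)
    (x : (jacobiOp ω).domain) : inner ℂ w (x : EllTwo) = inner ℂ y (jacobiOp ω x) := by
  obtain ⟨N, hN⟩ := exists_apply_eq_zero_of_mem_finSupp x.2
  rw [inner_eq_sum_of_right (n := N + 1 + 1) (fun k hk => hN k (by omega)),
    inner_eq_sum_of_right (n := N + 1 + 1) (fun k hk => jacobiAction_eq_zero hN (by omega))]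
  have h := sum_mul_jacobiAction_sub (ω := ω) (fun k => star (y k)) (x : EllTwo) (N + 1)
  rw [hN (N + 1) (by omega), hN (N + 1 + 1) (by omega)] at h
  simp only [jacobiAction_star, ← hw, mul_zero, sub_zero] at h
  exact (sub_eq_zero.1 h).symm

theorem mem_adjoint_domain {y w : EllTwo} (hw : ∀ n, w n = jacobiAction ω y n) :
    y ∈ (jacobiOp ω).adjoint.domain :=
  LinearPMap.mem_adjoint_domain_of_exists _ ⟨w, inner_jacobiOp hw⟩

theorem adjoint_apply_of_jacobiAction {y w : EllTwo} (hw : ∀ n, w n = jacobiAction ω y n)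
    (hy : y ∈ (jacobiOp ω).adjoint.domain) : (jacobiOp ω).adjoint ⟨y, hy⟩ = w :=
  LinearPMap.adjoint_apply_eq dense_finSupp _ fun x => inner_jacobiOp hw x

theorem inner_star_star (x y : EllTwo) : inner ℂ (star x) (star y) = inner ℂ y x := by
  rw [inner_star_left, star_star]

namespace IsLimitResolvent

variable {Y : EllTwo →L[ℂ] EllTwo}

theorem jacobiAction_eq (hY : IsLimitResolvent ω Y) (ξ : EllTwo) (n : ℕ) :
    (Complex.I • Y ξ - ξ) n = jacobiAction ω (Y ξ) n :=
  (hY.jacobiAction_apply ξ n).symm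

theorem range_le (hY : IsLimitResolvent ω Y) :
    LinearMap.range (Y : EllTwo →ₗ[ℂ] EllTwo) ≤ (jacobiOp ω).adjoint.domain := by
  rintro _ ⟨ξ, rfl⟩
  exact mem_adjoint_domain (hY.jacobiAction_eq ξ)

theorem mem_domain (hY : IsLimitResolvent ω Y) (ξ : EllTwo) :
    Y ξ ∈ (adjointOnImage ω Y).domain :=
  ⟨⟨ξ, rfl⟩, hY.range_le ⟨ξ, rfl⟩⟩

theorem adjointOnImage_apply (hY : IsLimitResolvent ω Y) (ξ : EllTwo)
    (h : Y ξ ∈ (adjointOnImage ω Y).domain) :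
    adjointOnImage ω Y ⟨Y ξ, h⟩ = Complex.I • Y ξ - ξ :=
  (LinearPMap.domRestrict_apply (y := ⟨Y ξ, h.2⟩) rfl).trans
    (adjoint_apply_of_jacobiAction (hY.jacobiAction_eq ξ) _)

theorem adjointOnImage_apply_of_eq (hY : IsLimitResolvent ω Y) {ξ : EllTwo}
    (x : (adjointOnImage ω Y).domain) (h : Y ξ = x) :
    adjointOnImage ω Y x = Complex.I • (x : EllTwo) - ξ := by
  obtain ⟨x, hx⟩ := x
  obtain rfl : Y ξ = x := h
  exact hY.adjointOnImage_apply ξ hx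

theorem isResolvent (hY : IsLimitResolvent ω Y) : IsResolvent (adjointOnImage ω Y) Complex.I Y := by
  refine ⟨fun ξ => ⟨hY.mem_domain ξ, ?_⟩, fun x => ?_⟩
  · rw [hY.adjointOnImage_apply, sub_sub_cancel]
  · obtain ⟨ξ, hξ⟩ := x.2.1
    rw [hY.adjointOnImage_apply_of_eq x hξ, sub_sub_cancel]
    exact hξ

/-- Testing against `star η`, bilinear symmetry moves `Y` onto `η`, and the Green formula moves `i -
X` onto `Y η`, where it gives back `η`. -/
theorem apply_sub_jacobiOp (hY : IsLimitResolvent ω Y) (x : (jacobiOp ω).domain) :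
    Y (Complex.I • (x : EllTwo) - jacobiOp ω x) = x := by
  refine ext_inner_left ℂ fun ζ => ?_
  obtain ⟨η, rfl⟩ : ∃ η, ζ = star η := ⟨star ζ, (star_star ζ).symm⟩
  rw [hY.inner_star]
  obtain ⟨N, hN⟩ := exists_apply_eq_zero_of_mem_finSupp x.2
  -- The Jacobi matrix enlarges the support by one index.
  have h0 : ∀ k, N + 1 + 1 ≤ k → star (Complex.I • (x : EllTwo) - jacobiOp ω x) k = 0 := by
    intro k hk
    rw [lp.star_apply, lp.coeFn_sub, Pi.sub_apply, lp.coeFn_smul, Pi.smul_apply,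
      jacobiOp_apply, jacobiAction_eq_zero hN (by omega), hN k (by omega)]
    simp
  rw [inner_eq_sum_of_left h0,
    inner_eq_sum_of_right (n := N + 1 + 1) (fun k hk => hN k (by omega))]
  have h := sum_mul_jacobiAction_sub (ω := ω) (Y η) (x : EllTwo) (N + 1)
  rw [hN (N + 1) (by omega), hN (N + 1 + 1) (by omega), mul_zero, mul_zero, sub_zero, mul_zero,
    ← Finset.sum_sub_distrib] at h
  rw [← sub_eq_zero, ← Finset.sum_sub_distrib, ← neg_eq_zero, ← Finset.sum_neg_distrib]
  refine Eq.trans (Finset.sum_congr rfl fun k hk => ?_) h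
  rw [hY.jacobiAction_apply, lp.star_apply, lp.star_apply, star_star, star_star, lp.coeFn_sub,
    Pi.sub_apply, lp.coeFn_smul, Pi.smul_apply, jacobiOp_apply, smul_eq_mul]
  ring

theorem jacobiOp_le (hY : IsLimitResolvent ω Y) : jacobiOp ω ≤ adjointOnImage ω Y := by
  have hm : ∀ x : (jacobiOp ω).domain, (x : EllTwo) ∈ (adjointOnImage ω Y).domain := fun x => by
    have := hY.mem_domain (Complex.I • (x : EllTwo) - jacobiOp ω x)
    rwa [hY.apply_sub_jacobiOp x] at this
  refine ⟨fun x hx => hm ⟨x, hx⟩, fun x y hxy => ?_⟩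
  rw [hY.adjointOnImage_apply_of_eq y ((hY.apply_sub_jacobiOp x).trans hxy), hxy, sub_sub_cancel]

theorem isFormalAdjoint (hY : IsLimitResolvent ω Y) :
    (adjointOnImage ω Y).IsFormalAdjoint (adjointOnImage ω Y) := by
  intro x y
  obtain ⟨ξ, hξ⟩ := x.2.1
  obtain ⟨η, hη⟩ := y.2.1
  rw [hY.adjointOnImage_apply_of_eq x hξ, hY.adjointOnImage_apply_of_eq y hη, ← hξ, ← hη]
  have := hY.inner_sub ξ η
  simp only [inner_sub_left, inner_sub_right, inner_smul_left, inner_smul_right, Complex.conj_I,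
    ContinuousLinearMap.coe_coe]
  linear_combination this

theorem dense_domain (hY : IsLimitResolvent ω Y) :
    Dense ((adjointOnImage ω Y).domain : Set EllTwo) :=
  dense_finSupp.mono hY.jacobiOp_le.1

/-- Bilinear symmetry identifies the Hilbert adjoint `Y*` with the conjugate `ξ ↦ star (Y (star
ξ))`. -/
theorem inner_apply_left (hY : IsLimitResolvent ω Y) (ξ η : EllTwo) :
    inner ℂ (Y ξ) η = inner ℂ ξ (star (Y (star η))) := by
  have h := hY.inner_star ξ (star η)
  rw [star_star] at h
  have h2 := inner_star_star (star (Y (star η))) ξ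
  rw [star_star] at h2
  rw [← inner_conj_symm, h, inner_conj_symm, h2]

theorem inner_apply_right (hY : IsLimitResolvent ω Y) (ξ η : EllTwo) :
    inner ℂ ξ (Y η) = inner ℂ (star (Y (star ξ))) η := by
  rw [← inner_conj_symm, hY.inner_apply_left, inner_conj_symm]

/-- This reads `Y (1 + 2i Y*) = Y*`, so `Y*` has its image inside that of `Y`. It is `inner_sub` at
conjugated vectors, which interchanges `Y` and `Y*` in the product. -/
theorem star_apply_star_mem_range (hY : IsLimitResolvent ω Y) (ξ : EllTwo) :
    Y (ξ + (2 * Complex.I) • star (Y (star ξ))) = star (Y (star ξ)) := by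
  refine ext_inner_left ℂ fun η => ?_
  have h := hY.inner_sub (star ξ) (star η)
  have h1 : inner ℂ (star (Y (star η))) (star (Y (star ξ))) =
      inner ℂ (Y (star ξ)) (Y (star η)) :=
    inner_star_star _ _
  have h2 : inner ℂ (Y (star ξ)) (star η) = inner ℂ η (star (Y (star ξ))) := by
    have := inner_star_star (star (Y (star ξ))) η
    rwa [star_star] at this
  have h3 : inner ℂ (star ξ) (Y (star η)) = inner ℂ η (Y ξ) := by
    rw [inner_star_left, ← hY.inner_apply_right]
  rw [h2, h3] at h
  rw [map_add, map_smul, inner_add_right, inner_smul_right, hY.inner_apply_right η (star _), h1]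
  linear_combination -h

theorem isSelfAdjoint (hY : IsLimitResolvent ω Y) : IsSelfAdjoint (adjointOnImage ω Y) := by
  rw [LinearPMap.isSelfAdjoint_def]
  have hle := hY.isFormalAdjoint.le_adjoint hY.dense_domain
  refine (LinearPMap.eq_of_le_of_domain_eq hle (le_antisymm hle.1 fun y hy => ?_)).symm
  set w := (adjointOnImage ω Y).adjoint ⟨y, hy⟩ with hw
  -- With `T = adjointOnImage ω Y` and `w = T* y`, this is `y = Y* (-i - T*) y`, obtained by pairing
  -- with `T Y ξ = i Y ξ - ξ`. Hence `y` lies in the image of `Y`.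
  have h : y = star (Y (star (-(Complex.I • y) - w))) := by
    refine ext_inner_right ℂ fun ξ => ?_
    have h1 := LinearPMap.adjoint_isFormalAdjoint hY.dense_domain ⟨y, hy⟩ ⟨Y ξ, hY.mem_domain ξ⟩
    rw [hY.adjointOnImage_apply, ← hw] at h1
    rw [← hY.inner_apply_right]
    simp only [inner_sub_left, inner_sub_right, inner_neg_left, inner_smul_left, inner_smul_right,
      Complex.conj_I] at h1 ⊢
    linear_combination h1
  rw [h, ← hY.star_apply_star_mem_range]
  exact hY.mem_domain _

end IsLimitResolvent

end Operators

/-! ### Moments and monic orthogonal polynomials -/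

section Moments

variable {ω : ℕ → ℝ}

/-- The Jacobi matrix acting on arbitrary real sequences. -/
noncomputable def realJacobi (ω : ℕ → ℝ) : (ℕ → ℝ) →ₗ[ℝ] (ℕ → ℝ) where
  toFun v
    | 0 => Real.sqrt (ω 1) * v 1
    | n + 1 => Real.sqrt (ω (n + 1)) * v n + Real.sqrt (ω (n + 2)) * v (n + 2)
  map_add' v w := by
    funext n
    cases n <;> simp <;> ring
  map_smul' c v := by
    funext n
    cases n <;> simp <;> ring

theorem realJacobi_zero (v : ℕ → ℝ) : realJacobi ω v 0 = Real.sqrt (ω 1) * v 1 := rfl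

theorem realJacobi_succ (v : ℕ → ℝ) (n : ℕ) : realJacobi ω v (n + 1) =
    Real.sqrt (ω (n + 1)) * v n + Real.sqrt (ω (n + 2)) * v (n + 2) := rfl

theorem jacobiAction_ofReal (v : ℕ → ℝ) (n : ℕ) :
    jacobiAction ω (fun k => (v k : ℂ)) n = (realJacobi ω v n : ℂ) := by
  cases n <;> simp [jacobiAction, realJacobi_zero, realJacobi_succ]

/-- The moments `⟨X ^ n δ_0, δ_0⟩`. -/
noncomputable def moment (ω : ℕ → ℝ) (n : ℕ) : ℝ := (realJacobi ω ^ n) (Pi.single 0 1) 0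

/-- The monic orthogonal polynomials with Jacobi sequence `ω`. -/
noncomputable def monicPoly (ω : ℕ → ℝ) : ℕ → Polynomial ℝ
  | 0 => 1
  | 1 => Polynomial.X
  | n + 2 => Polynomial.X * monicPoly ω (n + 1) - Polynomial.C (ω (n + 1)) * monicPoly ω n

theorem monicPoly_monic_natDegree :
    ∀ n, (monicPoly ω n).Monic ∧ (monicPoly ω n).natDegree = n
  | 0 => by simp [monicPoly]
  | 1 => by simp [monicPoly, Polynomial.monic_X]
  | n + 2 => by
    obtain ⟨h1, h2⟩ := monicPoly_monic_natDegree n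
    obtain ⟨h3, h4⟩ := monicPoly_monic_natDegree (n + 1)
    have h5 : (Polynomial.X * monicPoly ω (n + 1)).Monic := Polynomial.monic_X.mul h3
    have h6 : (Polynomial.X * monicPoly ω (n + 1)).natDegree = n + 2 := by
      rw [Polynomial.natDegree_X_mul h3.ne_zero, h4]
    have h7 : (Polynomial.C (ω (n + 1)) * monicPoly ω n).natDegree <
        (Polynomial.X * monicPoly ω (n + 1)).natDegree := by
      rw [h6]
      exact (Polynomial.natDegree_C_mul_le _ _).trans_lt (by omega)
    rw [monicPoly]
    exact ⟨h5.sub_of_left (Polynomial.degree_lt_degree h7),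
      (Polynomial.natDegree_sub_eq_left_of_natDegree_lt h7).trans h6⟩

theorem momentFunctional_moment (p : Polynomial ℝ) :
    momentFunctional (moment ω) p =
      Polynomial.aeval (realJacobi ω) p (Pi.single 0 1) 0 := by
  rw [Polynomial.aeval_eq_sum_range, momentFunctional, Polynomial.sum_over_range _ (by simp)]
  simp [LinearMap.sum_apply, Finset.sum_apply, moment]

/-- The row version of `aeval_monicPoly_single`. Together they evaluate `(P_m(J) P_n(J) δ_0)_0`,
hence orthogonality, without any adjoint. -/
theorem aeval_monicPoly_zero (hω : ∀ n, 1 ≤ n → 0 < ω n) : ∀ (n : ℕ) (v : ℕ → ℝ),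
    Polynomial.aeval (realJacobi ω) (monicPoly ω n) v 0 =
      (∏ k ∈ Finset.range n, Real.sqrt (ω (k + 1))) * v n
  | 0, v => by simp [monicPoly]
  | 1, v => by simp [monicPoly, realJacobi_zero]
  | n + 2, v => by
    have h1 := aeval_monicPoly_zero hω n v
    have h2 := aeval_monicPoly_zero hω (n + 1) (realJacobi ω v)
    have h3 := Real.sq_sqrt (hω (n + 1) (by omega)).le
    rw [monicPoly, mul_comm Polynomial.X, map_sub, map_mul, map_mul, Polynomial.aeval_X,
      Polynomial.aeval_C, LinearMap.sub_apply, Module.End.mul_apply, Module.End.mul_apply,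
      Module.algebraMap_end_apply, Pi.sub_apply, Pi.smul_apply, h2, h1, smul_eq_mul,
      realJacobi_succ]
    simp only [Finset.prod_range_succ _ n, Finset.prod_range_succ _ (n + 1)]
    linear_combination (∏ k ∈ Finset.range n, Real.sqrt (ω (k + 1))) * v n * h3

theorem realJacobi_single_zero :
    realJacobi ω (Pi.single 0 1) = Real.sqrt (ω 1) • Pi.single 1 1 := by
  funext k
  match k with
  | 0 => simp [realJacobi_zero]
  | 1 => simp [realJacobi_succ]
  | k + 2 => simp [realJacobi_succ]

theorem realJacobi_single_succ (n : ℕ) :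
    realJacobi ω (Pi.single (n + 1) 1) =
      Real.sqrt (ω (n + 1)) • Pi.single n 1 + Real.sqrt (ω (n + 2)) • Pi.single (n + 2) 1 := by
  funext k
  cases k with
  | zero =>
    rcases n with _ | n <;> simp [realJacobi_zero]
  | succ k =>
    simp only [realJacobi_succ, Pi.add_apply, Pi.smul_apply, Pi.single_apply, smul_eq_mul]
    rcases eq_or_ne k (n + 1) with rfl | h1
    · have h0 : n + 1 + 1 ≠ n := by omega
      simp [h0]
    · by_cases h2 : n = k + 1
      · subst h2
        have h0 : k ≠ k + 1 + 1 := by omega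
        simp [h0]
      · have : k + 1 ≠ n := fun h => h2 h.symm
        have h3 : k + 2 ≠ n + 1 := by omega
        simp [h1, this, h3]

theorem aeval_monicPoly_single (hω : ∀ n, 1 ≤ n → 0 < ω n) : ∀ n : ℕ,
    Polynomial.aeval (realJacobi ω) (monicPoly ω n) (Pi.single 0 1) =
      (∏ k ∈ Finset.range n, Real.sqrt (ω (k + 1))) • Pi.single n 1
  | 0 => by simp [monicPoly]
  | 1 => by simp [monicPoly, realJacobi_single_zero]
  | n + 2 => by
    have h1 := aeval_monicPoly_single hω n
    have h2 := aeval_monicPoly_single hω (n + 1)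
    have h3 := Real.sq_sqrt (hω (n + 1) (by omega)).le
    rw [monicPoly, map_sub, map_mul, map_mul, Polynomial.aeval_X,
      Polynomial.aeval_C, LinearMap.sub_apply, Module.End.mul_apply, Module.End.mul_apply,
      Module.algebraMap_end_apply, h2, h1, map_smul, realJacobi_single_succ]
    funext k
    simp only [Pi.sub_apply, Pi.add_apply, Pi.smul_apply, smul_eq_mul,
      Finset.prod_range_succ _ n, Finset.prod_range_succ _ (n + 1)]
    linear_combination (∏ k ∈ Finset.range n, Real.sqrt (ω (k + 1))) *
      (Pi.single n (1 : ℝ) : ℕ → ℝ) k * h3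

theorem isJacobiSequence_moment (hω : ∀ n, 1 ≤ n → 0 < ω n) :
    IsJacobiSequence (moment ω) ω := by
  have hprod : ∀ m n, momentFunctional (moment ω) (monicPoly ω m * monicPoly ω n) =
      (∏ k ∈ Finset.range m, Real.sqrt (ω (k + 1))) *
        ((∏ k ∈ Finset.range n, Real.sqrt (ω (k + 1))) * (Pi.single n (1 : ℝ) : ℕ → ℝ) m) := by
    intro m n
    rw [momentFunctional_moment, map_mul, Module.End.mul_apply, aeval_monicPoly_zero hω,
      aeval_monicPoly_single hω, Pi.smul_apply, smul_eq_mul]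
  refine ⟨by simp [moment], monicPoly ω, monicPoly_monic_natDegree, fun m n hmn => ?_,
    fun n => ?_, by simp [monicPoly], fun n => by simp [monicPoly]⟩
  · simp [hprod, hmn]
  · have : 0 < ∏ k ∈ Finset.range n, Real.sqrt (ω (k + 1)) :=
      Finset.prod_pos fun k _ => sqrt_jacobi_pos hω k
    rw [hprod, Pi.single_eq_same, mul_one]
    positivity

/-- The vectors `X ^ n δ_0`. -/
noncomputable def jacobiOrbit (ω : ℕ → ℝ) : ℕ → (jacobiOp ω).domain
  | 0 => ⟨delta 0, delta_mem_finSupp 0⟩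
  | n + 1 => ⟨jacobiOp ω (jacobiOrbit ω n),
      jacobiAction_support_finite ω _ (jacobiOrbit ω n).2⟩

theorem jacobiOrbit_apply (n : ℕ) : ((jacobiOrbit ω n : EllTwo) : ℕ → ℂ) =
    fun k => (((realJacobi ω ^ n) (Pi.single 0 1) k : ℝ) : ℂ) := by
  induction n with
  | zero =>
    funext k
    by_cases h : k = 0 <;> simp [jacobiOrbit, delta_apply, h]
  | succ n ih =>
    funext k
    rw [jacobiOrbit, jacobiOp_apply, ih, jacobiAction_ofReal, pow_succ', Module.End.mul_apply]

/-- The orbit of `δ_0` stays finitely supported, so any extension acts on it as `jacobiOp ω` does.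
-/
theorem hasMoments_of_jacobiOp_le {T : EllTwo →ₗ.[ℂ] EllTwo} (h : jacobiOp ω ≤ T) :
    HasMoments T (moment ω) := by
  refine ⟨fun n => jacobiOrbit ω n, rfl, fun n => ⟨h.1 (jacobiOrbit ω n).2, ?_⟩, fun n => ?_⟩
  · exact (h.2 (x := jacobiOrbit ω n) rfl).symm
  · rw [inner_delta, jacobiOrbit_apply, moment]

end Moments

/-! ### Stieltjes transforms at `i` and the even-odd gap -/

section Stieltjes

variable {ω : ℕ → ℝ}

theorem tendsto_two_mul_atTop : Tendsto (fun m : ℕ => 2 * m) atTop atTop :=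
  tendsto_id.const_mul_atTop' two_pos

theorem tendsto_two_mul_add_one_atTop : Tendsto (fun m : ℕ => 2 * m + 1) atTop atTop :=
  (tendsto_add_atTop_nat 1).comp tendsto_two_mul_atTop

/-- `G_m(i)` involves `m + 1` terms, so even truncations correspond to sums of odd length; these
carry the extra limit `s`. -/
theorem exists_tendsto_altSum {s : ℝ} (hs : Tendsto (fun m => (sqSum ω m)⁻¹) atTop (𝓝 s)) :
    ∃ t, Tendsto (fun m => altSum ω (2 * m + 1) 0) atTop (𝓝 (t + s)) ∧
      Tendsto (fun m => altSum ω (2 * m + 1 + 1) 0) atTop (𝓝 t) := by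
  obtain ⟨t, ht⟩ := exists_tendsto_altSum_even (ω := ω)
  refine ⟨t, ?_, ht.comp (tendsto_add_atTop_nat 1)⟩
  refine (ht.add (tendsto_altSum_odd_sub hs)).congr fun m => ?_
  ring

theorem tendsto_truncStieltjes (hω : ∀ n, 1 ≤ n → 0 < ω n) {σ : ℕ → ℕ} {t : ℝ}
    (h : Tendsto (fun m => altSum ω (σ m + 1) 0) atTop (𝓝 t)) :
    Tendsto (fun m => truncStieltjes ω (σ m)) atTop (𝓝 (-Complex.I * t)) := by
  simp only [truncStieltjes_eq hω]
  exact ((Complex.continuous_ofReal.tendsto _).comp h).const_mul _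

theorem exists_sqSum_le (hω : ∀ n, 1 ≤ n → 0 < ω n) (hSC : PropertySC ω) :
    ∃ C, ∀ n, sqSum ω n ≤ C := by
  rcases hSC with h | ⟨L, hL, h⟩ | ⟨S, h⟩
  -- If `sqSum ω` were unbounded, the gap `s` would be `0` and both parities would have the same
  -- limit.
  · by_contra hC
    obtain ⟨t, h1, h2⟩ := exists_tendsto_altSum (tendsto_sqSum_inv_of_not_bound hC)
    rw [add_zero] at h1
    exact h ((tendsto_truncStieltjes hω (σ := fun m => 2 * m) h1).limUnder_eq.trans
      (tendsto_truncStieltjes hω (σ := fun m => 2 * m + 1) h2).limUnder_eq.symm)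
  · by_contra hC
    simp only [prod_one_sub_seqB_div hω] at h
    exact hL.ne' (tendsto_nhds_unique h (tendsto_sqSum_inv_of_not_bound hC))
  · exact sqSum_bound_of_sum hω h

theorem IsStrongLimit.inner_delta_zero {σ : ℕ → ℕ} (hω : ∀ n, 1 ≤ n → 0 < ω n)
    {Y : EllTwo →L[ℂ] EllTwo} (hY : IsStrongLimit (fun m => truncResolvent ω (σ m)) Y) {g : ℂ}
    (hg : Tendsto (fun m => truncStieltjes ω (σ m)) atTop (𝓝 g)) :
    inner ℂ (delta 0) (Y (delta 0)) = g := by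
  rw [inner_delta]
  refine tendsto_nhds_unique (tendsto_apply (hY (delta 0)) 0) (hg.congr fun m => ?_)
  rw [truncResolvent_apply hω, truncStieltjes, truncResolventMatrix_apply hω]
  simp [delta_apply]

end Stieltjes

end JacobiMoment

open JacobiMoment
theorem mainTheorem7 (ω : ℕ → ℝ) (hω : ∀ n, 1 ≤ n → 0 < ω n) (hSC : PropertySC ω) :
    ∃ Yeven Yodd : EllTwo →L[ℂ] EllTwo,
      IsStrongLimit (fun m => truncResolvent ω (2 * m)) Yeven ∧
      IsStrongLimit (fun m => truncResolvent ω (2 * m + 1)) Yodd ∧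
      LinearMap.range (Yeven : EllTwo →ₗ[ℂ] EllTwo) ≤ (jacobiOp ω).adjoint.domain ∧
      LinearMap.range (Yodd : EllTwo →ₗ[ℂ] EllTwo) ≤ (jacobiOp ω).adjoint.domain ∧
      -- extensions of the Jacobi operator
      jacobiOp ω ≤ adjointOnImage ω Yeven ∧
      jacobiOp ω ≤ adjointOnImage ω Yodd ∧
      -- self-adjointness
      IsSelfAdjoint (adjointOnImage ω Yeven) ∧
      IsSelfAdjoint (adjointOnImage ω Yodd) ∧
      -- moments of all orders, with Jacobi sequence `ω`
      (∃ M : ℕ → ℝ,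
        HasMoments (jacobiOp ω) M ∧
        HasMoments (adjointOnImage ω Yeven) M ∧
        HasMoments (adjointOnImage ω Yodd) M ∧
        IsJacobiSequence M ω) ∧
      -- the Stieltjes transforms at `i`
      Tendsto (fun m : ℕ => truncStieltjes ω (2 * m)) atTop (𝓝 (GEven ω)) ∧
      Tendsto (fun m : ℕ => truncStieltjes ω (2 * m + 1)) atTop (𝓝 (GOdd ω)) ∧
      HasStieltjesTransform (adjointOnImage ω Yeven) Complex.I (GEven ω) ∧
      HasStieltjesTransform (adjointOnImage ω Yodd) Complex.I (GOdd ω) ∧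
      GEven ω ≠ GOdd ω := by
  obtain ⟨C, hC⟩ := exists_sqSum_le hω hSC
  have hb := summable_absPoly_sq hC
  obtain ⟨s, hs, hlim⟩ := tendsto_sqSum_inv_of_bound hC
  obtain ⟨t, h1, h2⟩ := exists_tendsto_altSum hlim
  obtain ⟨Ye, hYe⟩ := exists_strongLimit hω hb tendsto_two_mul_atTop h1
  obtain ⟨Yo, hYo⟩ := exists_strongLimit hω hb tendsto_two_mul_add_one_atTop h2
  have he := hYe.isLimitResolvent hω tendsto_two_mul_atTop
  have ho := hYo.isLimitResolvent hω tendsto_two_mul_add_one_atTop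
  have ge := tendsto_truncStieltjes hω (σ := fun m => 2 * m) h1
  have go := tendsto_truncStieltjes hω (σ := fun m => 2 * m + 1) h2
  have e1 : GEven ω = -Complex.I * ((t + s : ℝ) : ℂ) := ge.limUnder_eq
  have e2 : GOdd ω = -Complex.I * (t : ℂ) := go.limUnder_eq
  rw [← e1] at ge
  rw [← e2] at go
  refine ⟨Ye, Yo, hYe, hYo, he.range_le, ho.range_le, he.jacobiOp_le, ho.jacobiOp_le,
    he.isSelfAdjoint, ho.isSelfAdjoint,
    ⟨moment ω, hasMoments_of_jacobiOp_le le_rfl, hasMoments_of_jacobiOp_le he.jacobiOp_le,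
      hasMoments_of_jacobiOp_le ho.jacobiOp_le, isJacobiSequence_moment hω⟩,
    ge, go, ⟨Ye, he.isResolvent, hYe.inner_delta_zero hω ge⟩,
    ⟨Yo, ho.isResolvent, hYo.inner_delta_zero hω go⟩, ?_⟩
  rw [e1, e2]
  intro h
  have h3 := mul_left_cancel₀ (neg_ne_zero.2 Complex.I_ne_zero) h
  have h4 : t + s = t := by exact_mod_cast h3
  linarith
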